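/- Let $n$ agents with cyclic indices (modulo $n$) have shape variables $\xi=(\rho_i,\kappa_i,\theta_i,\rho_{ib},\kappa_{ib})_{i=1}^n\in\mathbb R^{5n}$, and let $\mu>0$, $\lambda\in(0,1)$, $\alpha_0\in\mathbb R$, and $\alpha_i=\alpha\in\mathbb R$ for all $i$. The closed-loop shape dynamics of beacon-referenced cyclic pursuit are, with $\gamma_i=\frac{1}{\rho_i}(\sin\kappa_i+\sin\theta_{i+1})$, $$\dot\rho_i=-(\cos\kappa_i+\cos\theta_{i+1}),\qquad \dot\kappa_i=-\mu[(1-\lambda)\sin(\kappa_i-\alpha_i)+\lambda\sin(\kappa_{ib}-\alpha_0)]+\lambda\gamma_i,$$ $$\dot\theta_i=\dot\kappa_i-\gamma_i+\gamma_{i-1},\qquad \dot\rho_{ib}=-\cos\kappa_{ib},\qquad \dot\kappa_{ib}=\dot\kappa_i-\gamma_i+\tfrac{1}{\rho_{ib}}\sin\kappa_{ib},$$ on the shape space $\mathcal M$ of all $\xi$ such that $\sum_i(\pi+\kappa_i-\theta_{i+1})\in2\pi\mathbb Z$ and, for all $i$, $\rho_i=\rho_{ib}\cos(\kappa_{ib}-\kappa_i)+\rho_{i+1,b}\cos(\kappa_{i+1,b}-\theta_{i+1})$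 and $0=\rho_{ib}\sin(\kappa_{ib}-\kappa_i)+\rho_{i+1,b}\sin(\kappa_{i+1,b}-\theta_{i+1})$. Let $\bar\xi\in\mathcal M$ be a counter-clockwise circling equilibrium on the leftmost branch, i.e. an equilibrium with all $\rho_i,\rho_{ib}>0$, with $\kappa_{ib}=\pi/2$ for all $i$, with $\kappa_i-\alpha_i$ the same for all $i$, and with $\sum_i\kappa_i=m\pi$, $m\in\mathbb Z$ (so that $\kappa_i=m\pi/n$). Call $\bar\xi$ stable if all eigenvalues of the linearization of the shape dynamics at $\bar\xi$, restricted to the $(3n-1)$-dimensional tangent space of $\mathcal M$ at $\bar\xi$ (the kernel of the derivative of the $2n+1$ constraints), have negative real part. Put $\alpha^*=\frac{m\pi}{n}-\alpha$ and $$a=\cos\alpha_0+\big(\tfrac1\lambda-1\big)\sin\alpha^*,\quad b=\lambda\sin\alpha_0+(1-\lambda)\cos\alpha^*,\quad d=a+(1-\lambda)\cos\alpha^*\cot\tfrac{m\pi}{n},$$ and, with $s_k=\sin\frac{k\pi}{n}$ and $t_k=\cos\frac{k\pi}{n}$, $$\tilde c_k=b+a(1-\lambda)s_k^2\cot\tfrac{m\pi}{n},\quad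 \hat c_k=a(1-\lambda)s_kt_k\cot\tfrac{m\pi}{n},\quad \tilde d_k=d\,s_k^2+\lambda a\,t_k^2,\quad \hat d_k=(\lambda a-d)s_kt_k,$$ $$\tilde e_k=(1-\lambda)\cos\alpha^*\,s_k^2,\quad \hat e_k=(1-\lambda)\cos\alpha^*\,s_kt_k,$$ $$\Gamma_k=\tilde c_k(\tilde c_k\tilde d_k-\hat c_k\hat d_k)-a(\hat d_k^2+\tilde c_k\tilde e_k),\quad \Lambda_k=\tilde c_k(\hat c_k\tilde e_k-\tilde c_k\hat e_k)+a\hat d_k\tilde e_k.$$ If $\bar\xi$ is stable, then $$\tilde c_k>0,\qquad \tilde c_k(\tilde c_k\tilde d_k-a\tilde e_k)-\hat d_k(\tilde c_k\hat c_k+a\hat d_k)>0\qquad\text{for each }k=0,\dots,n-1,$$ and $$\Gamma_k^2\tilde e_k+\Gamma_k\Lambda_k\hat d_k-\Lambda_k^2\tilde c_k>0\qquad\text{for each }k=1,\dots,n-1.$$ -/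

import Mathlib

/-!
Beacon-referenced cyclic constant-bearing pursuit with `n` agents, indexed cyclically by `ZMod n`.
-/

namespace BeaconPursuit

noncomputable section

/-- Parameters of the pursuit law: common gain `μ`, balance `lam` between neighbour and beacon,
common desired bearing `α₀` to the beacon, desired bearings `α i` to the pursued neighbour. -/
structure Params (n : ℕ) where
  μ : ℝ
  lam : ℝ
  α₀ : ℝ
  α : ZMod n → ℝ

/-- Collective shapes `ξ`: agent `i` has the block `ξ i = (ρ i, κ i, θ i, ρ_b i, κ_b i)`. -/
abbrev Shape (n : ℕ) : Type := ZMod n → Fin 5 → ℝ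

namespace Shape

variable {n : ℕ}

/-- Distance from agent `i` to agent `i + 1`. -/
abbrev ρ (ξ : Shape n) (i : ZMod n) : ℝ := ξ i 0

/-- Bearing of agent `i + 1` relative to the heading of agent `i`. -/
abbrev κ (ξ : Shape n) (i : ZMod n) : ℝ := ξ i 1

/-- Bearing of agent `i - 1` relative to the heading of agent `i`. -/
abbrev θ (ξ : Shape n) (i : ZMod n) : ℝ := ξ i 2

/-- Distance from agent `i` to the beacon. -/
abbrev ρb (ξ : Shape n) (i : ZMod n) : ℝ := ξ i 3

/-- Bearing of the beacon relative to the heading of agent `i`. -/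
abbrev κb (ξ : Shape n) (i : ZMod n) : ℝ := ξ i 4

end Shape

open Shape

variable {n : ℕ}

/-- The quantity `(sin κ_i + sin θ_{i+1}) / ρ_i`. -/
def γ (ξ : Shape n) (i : ZMod n) : ℝ :=
  (Real.sin (ξ.κ i) + Real.sin (ξ.θ (i + 1))) / ξ.ρ i

/-- Right-hand side of the equation for `κ_i`. -/
def κdot (P : Params n) (ξ : Shape n) (i : ZMod n) : ℝ :=
  -P.μ * ((1 - P.lam) * Real.sin (ξ.κ i - P.α i) + P.lam * Real.sin (ξ.κb i - P.α₀))
    + P.lam * γ ξ i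

/-- The closed-loop shape vector field: the shape dynamics are `dξ/dt = shapeField P ξ`. -/
def shapeField (P : Params n) (ξ : Shape n) : Shape n := fun i =>
  ![-(Real.cos (ξ.κ i) + Real.cos (ξ.θ (i + 1))),
    κdot P ξ i,
    κdot P ξ i - γ ξ i + γ ξ (i - 1),
    -Real.cos (ξ.κb i),
    κdot P ξ i - γ ξ i + Real.sin (ξ.κb i) / ξ.ρb i]

/-- Total turning angle around the cycle. -/
def g₀ [NeZero n] (ξ : Shape n) : ℝ := ∑ i, (Real.pi + ξ.κ i - ξ.θ (i + 1))

/-- First component of the mismatch in the triangle formed by agents `i`, `i + 1`, the beacon. -/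
def g₁ (ξ : Shape n) (i : ZMod n) : ℝ :=
  ξ.ρ i - ξ.ρb i * Real.cos (ξ.κb i - ξ.κ i)
    - ξ.ρb (i + 1) * Real.cos (ξ.κb (i + 1) - ξ.θ (i + 1))

/-- Second component of the mismatch in the triangle formed by agents `i`, `i + 1`, the beacon. -/
def g₂ (ξ : Shape n) (i : ZMod n) : ℝ :=
  ξ.ρb i * Real.sin (ξ.κb i - ξ.κ i)
    + ξ.ρb (i + 1) * Real.sin (ξ.κb (i + 1) - ξ.θ (i + 1))

/-- The shape space: shapes which satisfy the cycle closure constraint (the rotation through the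
angle `g₀ ξ` is the identity) and the consistency conditions. -/
def shapeSpace (n : ℕ) [NeZero n] : Set (Shape n) :=
  {ξ | (∃ l : ℤ, g₀ ξ = l * (2 * Real.pi)) ∧ (∀ i, g₁ ξ i = 0) ∧ ∀ i, g₂ ξ i = 0}

/-- All `2n + 1` constraint functions together. -/
def constraints [NeZero n] (ξ : Shape n) : ℝ × (ZMod n → ℝ) × (ZMod n → ℝ) :=
  (g₀ ξ, g₁ ξ, g₂ ξ)

/-- The tangent space of the shape space at `ξ`: the kernel of the derivative of the
constraints. -/
def tangentSpace [NeZero n] (ξ : Shape n) : Submodule ℝ (Shape n) :=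
  LinearMap.ker (fderiv ℝ (constraints (n := n)) ξ).toLinearMap

/-- The linearization (Jacobian) of the shape dynamics at `ξ`. -/
def linearization [NeZero n] (P : Params n) (ξ : Shape n) : Shape n →L[ℝ] Shape n :=
  fderiv ℝ (shapeField P) ξ

/-- `z` is an eigenvalue of the linearization along the shape space, with complex eigenvector
`u + j v`, where `u` and `v` are tangent to the shape space. -/
def IsShapeEigenvalue [NeZero n] (P : Params n) (ξ : Shape n) (z : ℂ) : Prop :=
  ∃ u ∈ tangentSpace ξ, ∃ v ∈ tangentSpace ξ, (u ≠ 0 ∨ v ≠ 0) ∧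
    linearization P ξ u = z.re • u - z.im • v ∧
    linearization P ξ v = z.im • u + z.re • v

/-- Stability of an equilibrium of the shape dynamics, as decided by the linearization: all
eigenvalues of the linearization restricted to the (tangent space of the) shape space lie in the
open left half plane. -/
def IsLinearlyStable [NeZero n] (P : Params n) (ξ : Shape n) : Prop :=
  ∀ z : ℂ, IsShapeEigenvalue P ξ z → z.re < 0

/-- `ξ` is a counter-clockwise circling equilibrium of the shape dynamics on the leftmost solution
branch, on which `κ_i - α_i` is the same for all agents; `m` is the integer in the closure
condition `∑ κ_i = m π`. -/
structure IsCCWCirclingEquilibrium [NeZero n] (P : Params n) (m : ℤ) (ξ : Shape n) : Prop where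
  mem_shapeSpace : ξ ∈ shapeSpace n
  equilibrium : shapeField P ξ = 0
  ρ_pos : ∀ i, 0 < ξ.ρ i
  ρb_pos : ∀ i, 0 < ξ.ρb i
  ccw : ∀ i, ξ.κb i = Real.pi / 2
  leftmost : ∀ i, ξ.κ (i + 1) - P.α (i + 1) = ξ.κ i - P.α i
  closure : ∑ i, ξ.κ i = m * Real.pi

/-! Coefficients of the stability conditions, as functions of the number of agents `n`, the integer
`m`, the parameters `lam`, `α₀`, the common value `α` of the `α_i`, and the mode number `k`. -/

/-- `α* = m π / n - α`. -/
def αstar (n : ℕ) (m : ℤ) (α : ℝ) : ℝ := m * Real.pi / n - α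

/-- The coefficient `a`. -/
def coeffA (n : ℕ) (m : ℤ) (lam α₀ α : ℝ) : ℝ :=
  Real.cos α₀ + (1 / lam - 1) * Real.sin (αstar n m α)

/-- The coefficient `b`. -/
def coeffB (n : ℕ) (m : ℤ) (lam α₀ α : ℝ) : ℝ :=
  lam * Real.sin α₀ + (1 - lam) * Real.cos (αstar n m α)

/-- The coefficient `d`. -/
def coeffD (n : ℕ) (m : ℤ) (lam α₀ α : ℝ) : ℝ :=
  coeffA n m lam α₀ α
    + (1 - lam) * Real.cos (αstar n m α) * Real.cot (m * Real.pi / n)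

/-- `c̃_k`. -/
def cTilde (n : ℕ) (m : ℤ) (lam α₀ α : ℝ) (k : ℕ) : ℝ :=
  coeffB n m lam α₀ α
    + coeffA n m lam α₀ α * (1 - lam) * Real.sin (k * Real.pi / n) ^ 2
      * Real.cot (m * Real.pi / n)

/-- `ĉ_k`. -/
def cHat (n : ℕ) (m : ℤ) (lam α₀ α : ℝ) (k : ℕ) : ℝ :=
  coeffA n m lam α₀ α * (1 - lam) * Real.sin (k * Real.pi / n) * Real.cos (k * Real.pi / n)
    * Real.cot (m * Real.pi / n)

/-- `d̃_k`. -/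
def dTilde (n : ℕ) (m : ℤ) (lam α₀ α : ℝ) (k : ℕ) : ℝ :=
  coeffD n m lam α₀ α * Real.sin (k * Real.pi / n) ^ 2
    + lam * coeffA n m lam α₀ α * Real.cos (k * Real.pi / n) ^ 2

/-- `d̂_k`. -/
def dHat (n : ℕ) (m : ℤ) (lam α₀ α : ℝ) (k : ℕ) : ℝ :=
  (lam * coeffA n m lam α₀ α - coeffD n m lam α₀ α)
    * Real.sin (k * Real.pi / n) * Real.cos (k * Real.pi / n)

/-- `ẽ_k`. -/
def eTilde (n : ℕ) (m : ℤ) (lam α : ℝ) (k : ℕ) : ℝ :=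
  (1 - lam) * Real.cos (αstar n m α) * Real.sin (k * Real.pi / n) ^ 2

/-- `ê_k`. -/
def eHat (n : ℕ) (m : ℤ) (lam α : ℝ) (k : ℕ) : ℝ :=
  (1 - lam) * Real.cos (αstar n m α)
    * Real.sin (k * Real.pi / n) * Real.cos (k * Real.pi / n)

/-- `Γ_k`. -/
def Gam (n : ℕ) (m : ℤ) (lam α₀ α : ℝ) (k : ℕ) : ℝ :=
  cTilde n m lam α₀ α k
      * (cTilde n m lam α₀ α k * dTilde n m lam α₀ α k - cHat n m lam α₀ α k * dHat n m lam α₀ α k)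
    - coeffA n m lam α₀ α
      * (dHat n m lam α₀ α k * dHat n m lam α₀ α k + cTilde n m lam α₀ α k * eTilde n m lam α k)

/-- `Λ_k`. -/
def Lam (n : ℕ) (m : ℤ) (lam α₀ α : ℝ) (k : ℕ) : ℝ :=
  cTilde n m lam α₀ α k
      * (cHat n m lam α₀ α k * eTilde n m lam α k - cTilde n m lam α₀ α k * eHat n m lam α k)
    + coeffA n m lam α₀ α * dHat n m lam α₀ α k * eTilde n m lam α k

end

end BeaconPursuit

open BeaconPursuit

/-! At a circling equilibrium every agent carries the same data, with `a > 0` and beacon distance `R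
= 1 / (μ a)`, so the linearization commutes with the cyclic shift and Fourier modes `χ (i + 1) = ω χ
i`, `ω = exp (2πik/n)`, can be tested one at a time. Tangency to the triangle constraints expresses
the amplitudes of `ρ` and `θ` through the others, and the `ρb` row gives `w = z s`. What remains is
a homogeneous 2×2 system in the amplitudes of `κ` and `ρb`. In units of `μ` its determinant is a
monic cubic in `ζ`, complex because `ω` is.

For `0 < k < n` every root of the cubic is an eigenvalue (`isShapeEigenvalue_of_root`), so stability
puts all three roots in the open left half plane. The Hurwitz inequalities for complex cubics
(`hurwitz_complex_cubic`) then give the claim after positive powers of `a` are cancelled. For `k =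
0` the cubic is `ζ` times a real quadratic, and closure excludes the factor `ζ`; the quadratic has
linear coefficient `b`, whence `b > 0`. Only the direction from roots to eigenvectors is needed. -/

namespace BeaconPursuit

open Shape

variable {n : ℕ}

/-! ### Hurwitz inequalities for complex cubics -/

/-- The second and third Hurwitz-type inequalities for a monic complex cubic whose roots
`-u + i v` lie in the open left half plane, in terms of the real and imaginary parts of the
roots. -/
theorem hurwitz_cubic {u₁ u₂ u₃ v₁ v₂ v₃ a₁ a₂ a₃ b₁ b₂ b₃ : ℝ}
    (hu₁ : 0 < u₁) (hu₂ : 0 < u₂) (hu₃ : 0 < u₃)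
    (ha₁ : a₁ = u₁ + u₂ + u₃) (hb₁ : b₁ = -(v₁ + v₂ + v₃))
    (ha₂ : a₂ = u₁ * u₂ - v₁ * v₂ + (u₁ * u₃ - v₁ * v₃) + (u₂ * u₃ - v₂ * v₃))
    (hb₂ : b₂ = -(u₁ * v₂ + v₁ * u₂ + (u₁ * v₃ + v₁ * u₃) + (u₂ * v₃ + v₂ * u₃)))
    (ha₃ : a₃ = u₁ * u₂ * u₃ - u₁ * v₂ * v₃ - v₁ * u₂ * v₃ - v₁ * v₂ * u₃)
    (hb₃ : b₃ = -(u₁ * u₂ * v₃ + u₁ * v₂ * u₃ + v₁ * u₂ * u₃ - v₁ * v₂ * v₃)) :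
    0 < a₁ ∧ 0 < a₁ ^ 2 * a₂ + a₁ * b₁ * b₂ - a₁ * a₃ - b₂ ^ 2 ∧
      0 < (a₁ ^ 2 * a₂ + a₁ * b₁ * b₂ - a₁ * a₃ - b₂ ^ 2) ^ 2 * a₃
        - (a₁ ^ 2 * a₂ + a₁ * b₁ * b₂ - a₁ * a₃ - b₂ ^ 2)
          * (a₁ * (b₁ * a₃ - a₁ * b₃) - b₂ * a₃) * b₂
        - (a₁ * (b₁ * a₃ - a₁ * b₃) - b₂ * a₃) ^ 2 * a₁ := by
  have h₁ : 0 < a₁ := by rw [ha₁]; positivity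
  refine ⟨h₁, ?_, ?_⟩
  · have : a₁ ^ 2 * a₂ + a₁ * b₁ * b₂ - a₁ * a₃ - b₂ ^ 2 =
        u₁ * u₂ * ((u₁ + u₂) ^ 2 + (v₁ - v₂) ^ 2) + u₂ * u₃ * ((u₂ + u₃) ^ 2 + (v₂ - v₃) ^ 2)
          + u₁ * u₃ * ((u₁ + 2 * u₂ + u₃) ^ 2 + (v₁ - v₃) ^ 2) := by
      subst ha₁ hb₁ ha₂ hb₂ ha₃; ring
    rw [this]; positivity
  · have e : (a₁ ^ 2 * a₂ + a₁ * b₁ * b₂ - a₁ * a₃ - b₂ ^ 2) ^ 2 * a₃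
        - (a₁ ^ 2 * a₂ + a₁ * b₁ * b₂ - a₁ * a₃ - b₂ ^ 2)
          * (a₁ * (b₁ * a₃ - a₁ * b₃) - b₂ * a₃) * b₂
        - (a₁ * (b₁ * a₃ - a₁ * b₃) - b₂ * a₃) ^ 2 * a₁ =
        a₁ ^ 2 * (-(a₂ * b₂ ^ 2 * a₃) + b₁ * b₂ * a₃ ^ 2 - b₂ ^ 3 * b₃ + a₃ ^ 3
          + a₁ * a₂ * b₁ * b₂ * a₃ - 2 * a₁ * a₂ * a₃ ^ 2 + a₁ * b₁ * b₂ ^ 2 * b₃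
          - a₁ * b₁ ^ 2 * a₃ ^ 2 - 3 * a₁ * b₂ * a₃ * b₃ + a₁ ^ 2 * a₂ * b₂ * b₃
          + a₁ ^ 2 * a₂ ^ 2 * a₃ + 2 * a₁ ^ 2 * b₁ * a₃ * b₃ - a₁ ^ 3 * b₃ ^ 2) := by
      ring
    -- Up to a constant the right side is the product of `z_i + conj z_j` over all pairs of roots,
    -- the diagonal pairs giving `u₁ u₂ u₃`.
    have e' : -(a₂ * b₂ ^ 2 * a₃) + b₁ * b₂ * a₃ ^ 2 - b₂ ^ 3 * b₃ + a₃ ^ 3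
          + a₁ * a₂ * b₁ * b₂ * a₃ - 2 * a₁ * a₂ * a₃ ^ 2 + a₁ * b₁ * b₂ ^ 2 * b₃
          - a₁ * b₁ ^ 2 * a₃ ^ 2 - 3 * a₁ * b₂ * a₃ * b₃ + a₁ ^ 2 * a₂ * b₂ * b₃
          + a₁ ^ 2 * a₂ ^ 2 * a₃ + 2 * a₁ ^ 2 * b₁ * a₃ * b₃ - a₁ ^ 3 * b₃ ^ 2 =
        u₁ * u₂ * u₃ * ((u₁ + u₂) ^ 2 + (v₁ - v₂) ^ 2) * ((u₁ + u₃) ^ 2 + (v₁ - v₃) ^ 2)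
          * ((u₂ + u₃) ^ 2 + (v₂ - v₃) ^ 2) := by
      subst ha₁ hb₁ ha₂ hb₂ ha₃ hb₃; ring
    rw [e, e']; positivity

/-- A monic complex cubic splits into linear factors; the coefficients are expressed by the
roots. -/
theorem exists_roots_of_cubic (A B C : ℂ) : ∃ x y z : ℂ,
    A = -(x + y + z) ∧ B = x * y + x * z + y * z ∧ C = -(x * y * z) := by
  obtain ⟨x, y, z, h⟩ :=
    (Cubic.splits_iff_roots_eq_three (P := Cubic.mk 1 A B C) (φ := RingHom.id ℂ) one_ne_zero).1
      (IsAlgClosed.splits _)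
  refine ⟨x, y, z, ?_, ?_, ?_⟩
  · simpa using Cubic.b_eq_three_roots (P := Cubic.mk 1 A B C) (φ := RingHom.id ℂ) one_ne_zero h
  · simpa using Cubic.c_eq_three_roots (P := Cubic.mk 1 A B C) (φ := RingHom.id ℂ) one_ne_zero h
  · simpa using Cubic.d_eq_three_roots (P := Cubic.mk 1 A B C) (φ := RingHom.id ℂ) one_ne_zero h

theorem hurwitz_complex_cubic {a₁ a₂ a₃ b₁ b₂ b₃ : ℝ}
    (h : ∀ z : ℂ, z ^ 3 + (a₁ + b₁ * Complex.I) * z ^ 2 + (a₂ + b₂ * Complex.I) * z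
      + (a₃ + b₃ * Complex.I) = 0 → z.re < 0) :
    0 < a₁ ∧ 0 < a₁ ^ 2 * a₂ + a₁ * b₁ * b₂ - a₁ * a₃ - b₂ ^ 2 ∧
      0 < (a₁ ^ 2 * a₂ + a₁ * b₁ * b₂ - a₁ * a₃ - b₂ ^ 2) ^ 2 * a₃
        - (a₁ ^ 2 * a₂ + a₁ * b₁ * b₂ - a₁ * a₃ - b₂ ^ 2)
          * (a₁ * (b₁ * a₃ - a₁ * b₃) - b₂ * a₃) * b₂
        - (a₁ * (b₁ * a₃ - a₁ * b₃) - b₂ * a₃) ^ 2 * a₁ := by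
  obtain ⟨x, y, z, hA, hB, hC⟩ := exists_roots_of_cubic (a₁ + b₁ * Complex.I)
    (a₂ + b₂ * Complex.I) (a₃ + b₃ * Complex.I)
  rw [hA, hB, hC] at h
  have hx := h x (by ring)
  have hy := h y (by ring)
  have hz := h z (by ring)
  simp only [Complex.ext_iff, Complex.add_re, Complex.add_im, Complex.mul_re, Complex.mul_im,
    Complex.neg_re, Complex.neg_im, Complex.ofReal_re, Complex.ofReal_im, Complex.I_re,
    Complex.I_im] at hA hB hC
  refine hurwitz_cubic (u₁ := -x.re) (u₂ := -y.re) (u₃ := -z.re) (v₁ := x.im) (v₂ := y.im)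
    (v₃ := z.im) (by linarith) (by linarith) (by linarith) ?_ ?_ ?_ ?_ ?_ ?_
  · linear_combination hA.1
  · linear_combination hA.2
  · linear_combination hB.1
  · linear_combination hB.2
  · linear_combination hC.1
  · linear_combination hC.2

/-- The two roots add up to `-a`. -/
theorem pos_of_quadratic_roots_re_neg {a b : ℝ}
    (h : ∀ z : ℂ, z ^ 2 + a * z + b = 0 → z.re < 0) : 0 < a := by
  obtain ⟨x, hx⟩ := IsAlgClosed.exists_pow_nat_eq ((a : ℂ) ^ 2 - 4 * b) (n := 2) (by norm_num)
  have h₁ := h ((-a + x) / 2) (by linear_combination hx / 4)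
  have h₂ := h ((-a - x) / 2) (by linear_combination hx / 4)
  simp at h₁ h₂
  linarith

/-! ### Geometry of the circling equilibrium -/

/-- Data of a circling equilibrium of the form considered: common bearings and distances. -/
structure IsCircling (ξ : Shape n) (φ R : ℝ) : Prop where
  R_pos : 0 < R
  sin_pos : 0 < Real.sin φ
  κ_eq : ∀ i, ξ.κ i = φ
  cosθ : ∀ i, Real.cos (ξ.θ i) = -Real.cos φ
  sinθ : ∀ i, Real.sin (ξ.θ i) = Real.sin φ
  ρ_eq : ∀ i, ξ.ρ i = 2 * R * Real.sin φ
  ρb_eq : ∀ i, ξ.ρb i = R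
  κb_eq : ∀ i, ξ.κb i = Real.pi / 2

theorem IsCCWCirclingEquilibrium.bearing_eq [NeZero n] {P : Params n} {α : ℝ}
    (hα : ∀ i, P.α i = α) {m : ℤ} {ξ : Shape n} (h : IsCCWCirclingEquilibrium P m ξ) (i : ZMod n) :
    ξ.κ i = m * Real.pi / n := by
  have hs : ∀ i, ξ.κ (i + 1) = ξ.κ i := fun i => by
    have := h.leftmost i
    rw [hα, hα] at this
    linarith
  have hc : ∀ k : ℕ, ξ.κ (k : ZMod n) = ξ.κ 0 := fun k => by
    induction k with
    | zero => simp
    | succ k ih => rw [Nat.cast_succ, hs, ih]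
  have hc' : ∀ i, ξ.κ i = ξ.κ 0 := fun i => by
    rw [← ZMod.natCast_zmod_val i]; exact hc _
  have hn : (n : ℝ) ≠ 0 := Nat.cast_ne_zero.2 (NeZero.ne n)
  have := h.closure
  simp only [hc', Finset.sum_const, Finset.card_univ, ZMod.card, nsmul_eq_mul] at this
  rw [hc', eq_div_iff hn, ← this, mul_comm]

/-- The `κb` equation forces `γ = 1 / ρb`; inserted in the `κ` equation this gives `1 / ρb = μ a`,
which fixes the radius and shows `a > 0`. -/
theorem IsCCWCirclingEquilibrium.isCircling [NeZero n] {P : Params n} {α : ℝ} (hμ : 0 < P.μ)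
    (hlam0 : 0 < P.lam) (hα : ∀ i, P.α i = α) {m : ℤ} {ξ : Shape n}
    (h : IsCCWCirclingEquilibrium P m ξ) :
    0 < coeffA n m P.lam P.α₀ α ∧
      IsCircling ξ (m * Real.pi / n) (1 / (P.μ * coeffA n m P.lam P.α₀ α)) := by
  have hκ := h.bearing_eq hα
  set φ : ℝ := m * Real.pi / n with hφ
  have hE : ∀ i j, shapeField P ξ i j = 0 := fun i j => by rw [h.equilibrium]; rfl
  have h0 : ∀ i, Real.cos (ξ.κ i) + Real.cos (ξ.θ (i + 1)) = 0 := fun i =>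
    neg_eq_zero.1 (hE i 0)
  have h1 : ∀ i, κdot P ξ i = 0 := fun i => hE i 1
  have h4 : ∀ i, κdot P ξ i - γ ξ i + Real.sin (ξ.κb i) / ξ.ρb i = 0 := fun i => hE i 4
  have hγ : ∀ i, γ ξ i = 1 / ξ.ρb i := fun i => by
    have := h4 i
    rw [h1, h.ccw, Real.sin_pi_div_two] at this
    linarith
  have hcos : ∀ i, Real.cos (ξ.θ i) = -Real.cos φ := fun i => by
    have := h0 (i - 1)
    rw [hκ, sub_add_cancel] at this
    linarith
  have hpos : ∀ i, 0 < Real.sin φ + Real.sin (ξ.θ i) := fun i => by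
    have e := hγ (i - 1)
    have hb := h.ρb_pos (i - 1)
    have hr := h.ρ_pos (i - 1)
    rw [γ, hκ, sub_add_cancel, div_eq_div_iff hr.ne' hb.ne', one_mul] at e
    exact pos_of_mul_pos_left (e ▸ hr) hb.le
  have hsin : ∀ i, Real.sin (ξ.θ i) = Real.sin φ := fun i => by
    have hsq : Real.sin (ξ.θ i) ^ 2 = Real.sin φ ^ 2 := by
      rw [Real.sin_sq, Real.sin_sq, hcos]; ring
    -- The opposite sign would make `γ` vanish, but `γ = 1 / ρb > 0`.
    rcases sq_eq_sq_iff_eq_or_eq_neg.1 hsq with e | e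
    · exact e
    · have := hpos i
      rw [e] at this
      linarith
  have hS : 0 < Real.sin φ := by
    have := hpos 0
    rw [hsin] at this
    linarith
  have hb : ∀ i, 1 / ξ.ρb i = P.μ * coeffA n m P.lam P.α₀ α := fun i => by
    have e := h1 i
    rw [κdot, hγ, hκ, hα, h.ccw, Real.sin_pi_div_two_sub] at e
    rw [coeffA, αstar, ← hφ]
    have hl := hlam0.ne'
    apply mul_left_cancel₀ hl
    field_simp
    field_simp at e
    linarith
  have hRb : ∀ i, ξ.ρb i = 1 / (P.μ * coeffA n m P.lam P.α₀ α) := fun i => by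
    rw [← hb i, one_div_one_div]
  have hR : 0 < P.μ * coeffA n m P.lam P.α₀ α := by
    rw [← hb 0]; exact one_div_pos.2 (h.ρb_pos 0)
  refine ⟨pos_of_mul_pos_right hR hμ.le, one_div_pos.2 hR, hS, hκ, hcos, hsin, fun i => ?_, hRb,
    h.ccw⟩
  have e := hγ i
  have hr := (h.ρ_pos i).ne'
  have hb' := (h.ρb_pos i).ne'
  rw [γ, hκ, hsin, div_eq_div_iff hr hb', one_mul] at e
  rw [← e, ← hRb i]; ring

/-! ### First variation of the vector field and of the constraints -/

theorem hasDerivAt_line (ξ u : Shape n) (i : ZMod n) (j : Fin 5) :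
    HasDerivAt (fun t : ℝ => (ξ + t • u) i j) (u i j) 0 := by
  simpa using ((hasDerivAt_id (0 : ℝ)).mul_const (u i j)).const_add (ξ i j)

/-- First variation of `γ` at a circling shape. -/
noncomputable def γVar (φ R : ℝ) (u : Shape n) (i : ZMod n) : ℝ :=
  (Real.cos φ * (u i 1 - u (i + 1) 2) - u i 0 / R) / (2 * R * Real.sin φ)

/-- First variation of `κdot` at a circling shape. -/
noncomputable def κVar (P : Params n) (φ R α : ℝ) (u : Shape n) (i : ZMod n) : ℝ :=
  -P.μ * ((1 - P.lam) * Real.cos (φ - α) * u i 1 + P.lam * Real.sin P.α₀ * u i 4)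
    + P.lam * γVar φ R u i

theorem hasDerivAt_γ {ξ : Shape n} {φ R : ℝ} (h : IsCircling ξ φ R) (u : Shape n) (i : ZMod n) :
    HasDerivAt (fun t : ℝ => γ (ξ + t • u) i) (γVar φ R u i) 0 := by
  have hR := h.R_pos.ne'
  have hS := h.sin_pos.ne'
  have hρ : (ξ + (0 : ℝ) • u) i 0 ≠ 0 := by
    have : ξ i 0 = 2 * R * Real.sin φ := h.ρ_eq i
    simp [this, hR, hS]
  have := (((hasDerivAt_line ξ u i 1).sin.add (hasDerivAt_line ξ u (i + 1) 2).sin).div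
    (hasDerivAt_line ξ u i 0) hρ)
  refine this.congr_deriv ?_
  have e0 : ξ i 0 = 2 * R * Real.sin φ := h.ρ_eq i
  have e1 : ξ i 1 = φ := h.κ_eq i
  have e2 : Real.cos (ξ (i + 1) 2) = -Real.cos φ := h.cosθ (i + 1)
  have e3 : Real.sin (ξ (i + 1) 2) = Real.sin φ := h.sinθ (i + 1)
  simp only [zero_smul, add_zero, e0, e1, e2, e3, γVar, Pi.add_apply, Pi.zero_apply]
  field_simp
  ring

theorem hasDerivAt_κdot {P : Params n} {α : ℝ} (hα : ∀ i, P.α i = α) {ξ : Shape n} {φ R : ℝ}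
    (h : IsCircling ξ φ R) (u : Shape n) (i : ZMod n) :
    HasDerivAt (fun t : ℝ => κdot P (ξ + t • u) i) (κVar P φ R α u i) 0 := by
  have := ((((hasDerivAt_line ξ u i 1).sub_const (P.α i)).sin.const_mul (1 - P.lam)).add
    (((hasDerivAt_line ξ u i 4).sub_const P.α₀).sin.const_mul P.lam)).const_mul (-P.μ)|>.add
    ((hasDerivAt_γ h u i).const_mul P.lam)
  refine this.congr_deriv ?_
  have e1 : ξ i 1 = φ := h.κ_eq i
  have e4 : ξ i 4 = Real.pi / 2 := h.κb_eq i
  simp only [zero_smul, add_zero, e1, e4, hα, κVar, Real.cos_pi_div_two_sub]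
  ring

theorem differentiableAt_shapeField [NeZero n] (P : Params n) {ξ : Shape n} {φ R : ℝ}
    (h : IsCircling ξ φ R) : DifferentiableAt ℝ (shapeField P) ξ := by
  have hρ : ∀ i, ξ i 0 ≠ 0 := fun i => by
    have : ξ i 0 = 2 * R * Real.sin φ := h.ρ_eq i
    simp [this, h.R_pos.ne', h.sin_pos.ne']
  have hρb : ∀ i, ξ i 3 ≠ 0 := fun i => by
    have : ξ i 3 = R := h.ρb_eq i
    simp [this, h.R_pos.ne']
  have hc : ∀ i j, DifferentiableAt ℝ (fun x : Shape n => x i j) ξ := fun i j => by fun_prop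
  have hγ : ∀ i, DifferentiableAt ℝ (fun x : Shape n => γ x i) ξ := fun i => by
    have : DifferentiableAt ℝ
        (fun x : Shape n => (Real.sin (x i 1) + Real.sin (x (i + 1) 2)) / x i 0) ξ := by
      simp only [div_eq_mul_inv]
      exact ((hc i 1).sin.add (hc (i + 1) 2).sin).mul ((hc i 0).fun_inv (hρ i))
    exact this
  have hκ : ∀ i, DifferentiableAt ℝ (fun x : Shape n => κdot P x i) ξ := fun i =>
    (((((hc i 1).sub_const _).sin.const_mul _).add
      (((hc i 4).sub_const _).sin.const_mul _)).const_mul _).add ((hγ i).const_mul _)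
  refine differentiableAt_pi.2 fun i => differentiableAt_pi.2 fun j => ?_
  fin_cases j
  · exact ((hc i 1).cos.add (hc (i + 1) 2).cos).neg
  · exact hκ i
  · exact ((hκ i).sub (hγ i)).add (hγ (i - 1))
  · exact (hc i 4).cos.neg
  · have : DifferentiableAt ℝ (fun x : Shape n => Real.sin (x i 4) / x i 3) ξ := by
      simp only [div_eq_mul_inv]
      exact (hc i 4).sin.mul ((hc i 3).fun_inv (hρb i))
    exact ((hκ i).sub (hγ i)).add this

/-- Once differentiability is known, the Fréchet derivative can be read off one coordinate at a time
along the line `ξ + t • u`. -/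
theorem linearization_apply [NeZero n] {P : Params n} {α : ℝ} (hα : ∀ i, P.α i = α) {ξ : Shape n}
    {φ R : ℝ} (h : IsCircling ξ φ R) (u : Shape n) :
    linearization P ξ u = fun i =>
      ![Real.sin φ * (u i 1 + u (i + 1) 2),
        κVar P φ R α u i,
        κVar P φ R α u i - γVar φ R u i + γVar φ R u (i - 1),
        u i 4,
        κVar P φ R α u i - γVar φ R u i - u i 3 / R ^ 2] := by
  have hline : HasDerivAt (fun t : ℝ => ξ + t • u) u 0 :=
    hasDerivAt_pi.2 fun i => hasDerivAt_pi.2 fun j => hasDerivAt_line ξ u i j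
  have hF : HasDerivAt (fun t : ℝ => shapeField P (ξ + t • u)) (linearization P ξ u) 0 := by
    have : HasFDerivAt (shapeField P) (linearization P ξ) (ξ + (0 : ℝ) • u) := by
      rw [zero_smul, add_zero]; exact (differentiableAt_shapeField P h).hasFDerivAt
    exact this.comp_hasDerivAt 0 hline
  funext i j
  refine (hasDerivAt_pi.1 (hasDerivAt_pi.1 hF i) j).unique ?_
  have e1 : ξ i 1 = φ := h.κ_eq i
  have e2 : Real.sin (ξ (i + 1) 2) = Real.sin φ := h.sinθ (i + 1)
  have e3 : ξ i 3 = R := h.ρb_eq i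
  have e4 : ξ i 4 = Real.pi / 2 := h.κb_eq i
  have hκ := hasDerivAt_κdot hα h u i
  have hγ := hasDerivAt_γ h u
  fin_cases j
  · refine (((hasDerivAt_line ξ u i 1).cos.add (hasDerivAt_line ξ u (i + 1) 2).cos).neg).congr_deriv
      ?_
    simp [e1, e2]; ring
  · exact hκ
  · exact (hκ.sub (hγ i)).add (hγ (i - 1))
  · refine (hasDerivAt_line ξ u i 4).cos.neg.congr_deriv ?_
    simp [e4]
  · refine ((hκ.sub (hγ i)).add ((hasDerivAt_line ξ u i 4).sin.div (hasDerivAt_line ξ u i 3)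
      ?_)).congr_deriv ?_
    · simp [e3, h.R_pos.ne']
    · simp [e3, e4]; ring

theorem mem_tangentSpace [NeZero n] {ξ : Shape n} {φ R : ℝ} (h : IsCircling ξ φ R) {u : Shape n}
    (h₀ : ∑ i, (u i 1 - u (i + 1) 2) = 0)
    (h₁ : ∀ i, u i 0 - Real.sin φ * (u i 3 + u (i + 1) 3)
      + R * Real.cos φ * (u i 4 - u i 1 - (u (i + 1) 4 - u (i + 1) 2)) = 0)
    (h₂ : ∀ i, Real.cos φ * (u i 3 - u (i + 1) 3)
      + R * Real.sin φ * (u i 4 - u i 1 + (u (i + 1) 4 - u (i + 1) 2)) = 0) :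
    u ∈ tangentSpace ξ := by
  have hline : HasDerivAt (fun t : ℝ => ξ + t • u) u 0 :=
    hasDerivAt_pi.2 fun i => hasDerivAt_pi.2 fun j => hasDerivAt_line ξ u i j
  have hd : Differentiable ℝ (constraints (n := n)) := by
    unfold constraints g₀ g₁ g₂
    refine Differentiable.prodMk ?_ (Differentiable.prodMk ?_ ?_)
    · fun_prop
    · exact differentiable_pi.2 fun i => by fun_prop
    · exact differentiable_pi.2 fun i => by fun_prop
  have hF : HasDerivAt (fun t : ℝ => constraints (ξ + t • u))
      (fderiv ℝ (constraints (n := n)) ξ u) 0 := by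
    have : HasFDerivAt (constraints) (fderiv ℝ (constraints (n := n)) ξ) (ξ + (0 : ℝ) • u) := by
      rw [zero_smul, add_zero]; exact (hd ξ).hasFDerivAt
    exact this.comp_hasDerivAt 0 hline
  have e1 : ∀ i, ξ i 1 = φ := h.κ_eq
  have e3 : ∀ i, ξ i 3 = R := h.ρb_eq
  have e4 : ∀ i, ξ i 4 = Real.pi / 2 := h.κb_eq
  have e2 : ∀ i, Real.sin (ξ i 2) = Real.sin φ := h.sinθ
  have e2' : ∀ i, Real.cos (ξ i 2) = -Real.cos φ := h.cosθ
  have d := hasDerivAt_line ξ u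
  refine LinearMap.mem_ker.2 (hF.unique ?_)
  refine HasDerivAt.prodMk ?_ (HasDerivAt.prodMk (hasDerivAt_pi.2 fun i => ?_)
    (hasDerivAt_pi.2 fun i => ?_))
  · refine (HasDerivAt.fun_sum fun i _ => ((d i 1).const_add Real.pi).sub
      (d (i + 1) 2)).congr_deriv h₀
  · refine (((d i 0).sub ((d i 3).mul ((d i 4).sub (d i 1)).cos)).sub
      ((d (i + 1) 3).mul ((d (i + 1) 4).sub (d (i + 1) 2)).cos)).congr_deriv ?_
    simp only [zero_smul, add_zero, e1, e3, e4, e2, e2', Real.cos_pi_div_two_sub,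
      Real.sin_pi_div_two_sub, Pi.sub_apply, Pi.zero_apply]
    linear_combination h₁ i
  · refine (((d i 3).mul ((d i 4).sub (d i 1)).sin).add
      ((d (i + 1) 3).mul ((d (i + 1) 4).sub (d (i + 1) 2)).sin)).congr_deriv ?_
    simp only [zero_smul, add_zero, e1, e3, e4, e2, e2', Real.cos_pi_div_two_sub,
      Real.sin_pi_div_two_sub, Pi.sub_apply, Pi.zero_apply]
    linear_combination h₂ i

/-! ### Fourier modes as eigenvectors -/

/-- A complex Fourier mode with factor `ω` between neighbours; `Y` is the amplitude of the
perturbation of `θ_{i+1}`. -/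
def modeVec (χ : ZMod n → ℂ) (r x Y s w : ℂ) : ZMod n → Fin 5 → ℂ := fun i =>
  ![χ i * r, χ i * x, χ (i - 1) * Y, χ i * s, χ i * w]

section
variable [NeZero n] {P : Params n} {α φ R S C : ℝ} {ξ : Shape n} {χ : ZMod n → ℂ}
  {ω r x Y s w : ℂ}

/-- The constraints are real-linear, so one argument with a real functional `ℓ` serves both the real
and the imaginary part of the mode. -/
theorem modeVec_mem_tangentSpace (h : IsCircling ξ φ R) (hS : Real.sin φ = S)
    (hC : Real.cos φ = C) (hχ : ∀ i, χ (i + 1) = ω * χ i) (h₀ : (x - Y) * ∑ i, χ i = 0)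
    (h₁ : r - S * (1 + ω) * s + R * C * ((1 - ω) * w - x + Y) = 0)
    (h₂ : C * (1 - ω) * s + R * S * ((1 + ω) * w - x - Y) = 0) (ℓ : ℂ →ₗ[ℝ] ℝ) :
    (fun i j => ℓ (modeVec χ r x Y s w i j) : Shape n) ∈ tangentSpace ξ := by
  refine mem_tangentSpace h ?_ (fun i => ?_) (fun i => ?_)
  · have : ∑ i, (χ i * x - χ i * Y) = 0 := by
      rw [← h₀, Finset.mul_sum]
      exact Finset.sum_congr rfl fun i _ => by ring
    simpa [modeVec] using congrArg ℓ this
  · have : χ i * r - S • (χ i * s + χ (i + 1) * s)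
        + (R * C) • (χ i * w - χ i * x - (χ (i + 1) * w - χ i * Y)) = 0 := by
      simp only [Complex.real_smul, hχ]
      push_cast
      linear_combination χ i * h₁
    simpa [modeVec, hS, hC, mul_add, -Complex.real_smul] using congrArg ℓ this
  · have : C • (χ i * s - χ (i + 1) * s)
        + (R * S) • (χ i * w - χ i * x + (χ (i + 1) * w - χ i * Y)) = 0 := by
      simp only [Complex.real_smul, hχ]
      push_cast
      linear_combination χ i * h₂
    simpa [modeVec, hS, hC, mul_add, -Complex.real_smul] using congrArg ℓ this

/-- Each row of the linearization becomes one scalar equation between amplitudes. The `ω` in `hY`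
appears because `θ_i` has phase `χ (i - 1)` while `κ_i` has phase `χ i`. -/
theorem linearization_modeVec (hα : ∀ i, P.α i = α) (h : IsCircling ξ φ R)
    (hS : Real.sin φ = S) (hC : Real.cos φ = C) (hχ : ∀ i, χ (i + 1) = ω * χ i) {z G : ℂ}
    {A B : ℝ} (hA : (1 - P.lam) * Real.cos (φ - α) = A) (hB : P.lam * Real.sin P.α₀ = B)
    (hG : G * (2 * R * S) * R = R * C * (x - Y) - r)
    (hr : S * (x + Y) = z * r) (hx : -P.μ * (A * x + B * w) + P.lam * G = z * x)
    (hY : ω * (z * x - G) + G = z * Y) (hs : w = z * s)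
    (hw : R ^ 2 * (z * x - G) - s = R ^ 2 * (z * w)) (ℓ : ℂ →ₗ[ℝ] ℝ) :
    linearization P ξ (fun i j => ℓ (modeVec χ r x Y s w i j)) =
      fun i j => ℓ (z * modeVec χ r x Y s w i j) := by
  have hR := h.R_pos.ne'
  have hS' : S ≠ 0 := hS ▸ h.sin_pos.ne'
  have hγ : ∀ i, γVar φ R (fun i j => ℓ (modeVec χ r x Y s w i j)) i = ℓ (χ i * G) := fun i => by
    have e : (2 * R * S * R) • (χ i * G) = (R * C) • (χ i * x - χ i * Y) - χ i * r := by
      simp only [Complex.real_smul]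
      push_cast
      linear_combination χ i * hG
    have e := congrArg ℓ e
    simp only [map_sub, map_smul, smul_eq_mul] at e
    simp only [γVar, modeVec, hS, hC, Matrix.cons_val, add_sub_cancel_right]
    field_simp
    linear_combination -e
  have hκ : ∀ i, κVar P φ R α (fun i j => ℓ (modeVec χ r x Y s w i j)) i = ℓ (z * (χ i * x)) :=
    fun i => by
    have e : (-P.μ * A) • (χ i * x) + (-P.μ * B) • (χ i * w) + P.lam • (χ i * G)
        = z * (χ i * x) := by
      simp only [Complex.real_smul]
      push_cast
      linear_combination χ i * hx
    have e := congrArg ℓ e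
    simp only [map_add, map_smul, smul_eq_mul] at e
    rw [← e, κVar, hγ, hA, hB]
    simp only [modeVec, Matrix.cons_val]
    ring
  rw [linearization_apply hα h]
  funext i j
  have hi : χ i = ω * χ (i - 1) := by rw [← hχ, sub_add_cancel]
  fin_cases j
  · have e : S • (χ i * x + χ i * Y) = z * (χ i * r) := by
      simp only [Complex.real_smul]
      linear_combination χ i * hr
    simpa [modeVec, hS, mul_add, -Complex.real_smul] using congrArg ℓ e
  · simpa [modeVec] using hκ i
  · have e : z * (χ i * x) - χ i * G + χ (i - 1) * G = z * (χ (i - 1) * Y) := by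
      rw [hi]
      linear_combination χ (i - 1) * hY
    have e := congrArg ℓ e
    simp only [map_add, map_sub] at e
    change κVar P φ R α (fun i j => ℓ (modeVec χ r x Y s w i j)) i
      - γVar φ R (fun i j => ℓ (modeVec χ r x Y s w i j)) i
      + γVar φ R (fun i j => ℓ (modeVec χ r x Y s w i j)) (i - 1) = ℓ (z * (χ (i - 1) * Y))
    rw [hκ, hγ, hγ, e]
  · have e : χ i * w = z * (χ i * s) := by rw [hs]; ring
    simpa [modeVec] using congrArg ℓ e
  · have e : (R ^ 2) • (z * (χ i * x) - χ i * G) - χ i * s = (R ^ 2) • (z * (χ i * w)) := by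
      simp only [Complex.real_smul]
      push_cast
      linear_combination χ i * hw
    have e := congrArg ℓ e
    simp only [map_sub, map_smul, smul_eq_mul] at e
    change κVar P φ R α (fun i j => ℓ (modeVec χ r x Y s w i j)) i
      - γVar φ R (fun i j => ℓ (modeVec χ r x Y s w i j)) i - ℓ (χ i * s) / R ^ 2
      = ℓ (z * (χ i * w))
    rw [hκ, hγ]
    generalize ℓ (z * (χ i * x)) = p₁ at e ⊢
    generalize ℓ (z * (χ i * w)) = p₂ at e ⊢
    field_simp
    linear_combination e

/-- A solution of the reduced equations of a Fourier mode is an eigenvector of the linearized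
shape dynamics. -/
theorem isShapeEigenvalue_of_mode (hμ : 0 < P.μ) (hα : ∀ i, P.α i = α) {a : ℝ} (ha : 0 < a)
    (h : IsCircling ξ φ (1 / (P.μ * a))) (hχ : ∀ i, χ (i + 1) = ω * χ i) (hχ0 : χ 0 ≠ 0)
    {A B c : ℝ} (hA : (1 - P.lam) * Real.cos (φ - α) = A) (hB : P.lam * Real.sin P.α₀ = B)
    (hc : Real.cot φ = c) {ζ σ g : ℂ} (hne : σ ≠ 0 ∨ x ≠ 0)
    (hg : 2 * g = a * (c * (1 - ω) * ζ - (1 + ω) * a) * σ)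
    (hx : ζ * x = -A * x - B * (ζ * σ) + P.lam * g)
    (hw : ζ * (ζ * σ) = ζ * x - g - a ^ 2 * σ)
    (h₀ : (x - ((1 + ω) * (ζ * σ) - x + c * (1 - ω) * a * σ)) * ∑ i, χ i = 0) :
    IsShapeEigenvalue P ξ (P.μ * ζ) := by
  obtain ⟨S, hS⟩ : ∃ S, Real.sin φ = S := ⟨_, rfl⟩
  obtain ⟨C, hC⟩ : ∃ C, Real.cos φ = C := ⟨_, rfl⟩
  have hS0 : S ≠ 0 := hS ▸ h.sin_pos.ne'
  have hCc : C = c * S := by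
    rw [← hc, Real.cot_eq_cos_div_sin, hS, hC, div_mul_cancel₀ _ hS0]
  obtain ⟨μ, hμe⟩ : ∃ μ, P.μ = μ := ⟨_, rfl⟩
  rw [hμe] at hμ h
  have hμ0 : (μ : ℂ) ≠ 0 := Complex.ofReal_ne_zero.2 hμ.ne'
  have ha0 : (a : ℂ) ≠ 0 := Complex.ofReal_ne_zero.2 ha.ne'
  have hR : (((1 / (μ * a) : ℝ)) : ℂ) = 1 / (μ * a) := by push_cast; rfl
  -- `Y` solves the second triangle constraint, divided by `sin φ`, and `r` solves the first; `s = σ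
  -- / μ` makes `w = ζ σ` agree with `w = z s` for `z = μ ζ`.
  set Y : ℂ := (1 + ω) * (ζ * σ) - x + c * (1 - ω) * a * σ with hYdef
  set s : ℂ := σ / μ with hsdef
  set r : ℂ := S * (1 + ω) * s - 1 / (μ * a) * C * ((1 - ω) * (ζ * σ) - x + Y) with hrdef
  have hCc' : (C : ℂ) = c * S := by rw [hCc]; push_cast; rfl
  have T := modeVec_mem_tangentSpace (r := r) (s := s) (w := ζ * σ) h hS hC hχ h₀
    (by rw [hR]; ring)
    (by rw [hR, hCc', hYdef, hsdef]; field_simp; ring)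
  -- The `ρ` and `θ` rows add no condition: given the constraints, both are combinations of `hw` and
  -- `hg`.
  have E := linearization_modeVec (P := P) (r := r) (x := x) (Y := Y) (s := s) (w := ζ * σ)
    (z := μ * ζ) (G := μ * g) hα h hS hC hχ hA hB
    (by
      rw [hR, hrdef, hYdef, hsdef, hCc']
      field_simp
      linear_combination (S : ℂ) * hg)
    (by
      rw [hrdef, hYdef, hsdef, hCc']
      field_simp
      linear_combination (2 * c * S : ℂ) * hw - (c * S : ℂ) * hg)
    (by rw [hμe]; linear_combination -(μ : ℂ) * hx)
    (by
      rw [hYdef]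
      linear_combination (-(μ : ℂ) * (1 + ω)) * hw + (μ : ℂ) * hg)
    (by rw [hsdef]; field_simp)
    (by
      rw [hR, hsdef]
      field_simp
      linear_combination -hw)
  rw [hμe]
  refine ⟨_, T Complex.reLm, _, T Complex.imLm, ?_, ?_, ?_⟩
  · by_contra! hcon
    have hz : ∀ j, modeVec χ r x Y s (ζ * σ) 0 j = 0 := fun j =>
      Complex.ext (congrFun (congrFun hcon.1 0) j) (congrFun (congrFun hcon.2 0) j)
    rcases hne with hn | hn
    · have : χ 0 * s = 0 := hz 3
      exact (mul_ne_zero hχ0 (div_ne_zero hn hμ0)) this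
    · have : χ 0 * x = 0 := hz 1
      exact (mul_ne_zero hχ0 hn) this
  · rw [E]
    funext i j
    simp [-Complex.mul_re, Complex.mul_re (_ * _)]
  · rw [E]
    funext i j
    simp
    ring
end

/-- A root `ζ` of the characteristic polynomial of a nonconstant Fourier mode, in units of `μ`,
gives an eigenvalue of the linearized shape dynamics. -/
theorem isShapeEigenvalue_of_root [NeZero n] {P : Params n} {α φ : ℝ} {ξ : Shape n}
    (hμ : 0 < P.μ) (hlam : 0 < P.lam) (hα : ∀ i, P.α i = α) {a : ℝ} (ha : 0 < a)
    (h : IsCircling ξ φ (1 / (P.μ * a))) {χ : ZMod n → ℂ} {ω : ℂ}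
    (hχ : ∀ i, χ (i + 1) = ω * χ i) (hχ0 : χ 0 ≠ 0) (hsum : ∑ i, χ i = 0)
    {A B c : ℝ} (hA : (1 - P.lam) * Real.cos (φ - α) = A) (hB : P.lam * Real.sin P.α₀ = B)
    (hc : Real.cot φ = c) {ζ q : ℂ} (hq : 2 * q = a * (c * (1 - ω) * ζ - (1 + ω) * a))
    (hζ : ζ ^ 3 + (A + B) * ζ ^ 2 + q * ((1 - P.lam) * ζ + A) + a ^ 2 * ζ + a ^ 2 * A = 0) :
    IsShapeEigenvalue P ξ (P.μ * ζ) := by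
  have ha0 : (a : ℂ) ≠ 0 := Complex.ofReal_ne_zero.2 ha.ne'
  -- With `g = q σ` the system reads `(ζ + A) x = (λ q - B ζ) σ` and `ζ x = (ζ² + q + a²) σ`, and
  -- `hζ` is its vanishing determinant. A kernel vector is read off the first row, or off the second
  -- if the first is zero; both rows vanishing would give `λ a² = 0`.
  by_cases hz : ζ + A = 0 ∧ P.lam * q - B * ζ = 0
  · refine isShapeEigenvalue_of_mode (σ := ζ) (x := ζ ^ 2 + q + a ^ 2) (g := q * ζ) hμ hα ha h hχ
      hχ0 hA hB hc ?_ ?_ ?_ ?_ (by rw [hsum, mul_zero])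
    · by_contra! hcon
      obtain ⟨h1, h2⟩ := hcon
      have h3 := hz.2
      rw [h1] at h2 h3
      have : (P.lam : ℂ) * a ^ 2 = 0 := by linear_combination P.lam * h2 - h3
      exact mul_ne_zero (Complex.ofReal_ne_zero.2 hlam.ne') (pow_ne_zero 2 ha0) this
    · linear_combination ζ * hq
    · linear_combination hζ
    · ring
  · refine isShapeEigenvalue_of_mode (σ := ζ + A) (x := P.lam * q - B * ζ) (g := q * (ζ + A))
      hμ hα ha h hχ hχ0 hA hB hc ?_ ?_ ?_ ?_ (by rw [hsum, mul_zero])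
    · by_contra! hcon
      exact hz hcon
    · linear_combination (ζ + A) * hq
    · ring
    · linear_combination hζ

/-- For the constant mode the sum of `χ` does not vanish, so closure demands `x = Y`; the choice `σ
= 1`, `x = ζ` achieves this. -/
theorem isShapeEigenvalue_of_root_zero [NeZero n] {P : Params n} {α φ : ℝ} {ξ : Shape n}
    (hμ : 0 < P.μ) (hα : ∀ i, P.α i = α) {a : ℝ} (ha : 0 < a)
    (h : IsCircling ξ φ (1 / (P.μ * a)))
    {A B : ℝ} (hA : (1 - P.lam) * Real.cos (φ - α) = A) (hB : P.lam * Real.sin P.α₀ = B)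
    {ζ : ℂ} (hζ : ζ ^ 2 + (A + B) * ζ + P.lam * a ^ 2 = 0) :
    IsShapeEigenvalue P ξ (P.μ * ζ) :=
  isShapeEigenvalue_of_mode (χ := fun _ => 1) (ω := 1) (σ := 1) (x := ζ) (g := -a ^ 2) hμ hα ha h
    (by simp) one_ne_zero hA hB rfl (.inl one_ne_zero) (by ring) (by linear_combination hζ)
    (by ring) (by ring)

/-! ### From stability to the inequalities -/

/-- The mode is the additive character `i ↦ exp (2πiki/n)`, nontrivial for `0 < k < n`, so its sum
is zero. Writing `ω` as a square brings in the half angle `kπ/n` of `s_k` and `t_k`. -/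
theorem exists_mode [NeZero n] {k : ℕ} (hk0 : k ≠ 0) (hk : k < n) :
    ∃ χ : ZMod n → ℂ, χ 0 ≠ 0 ∧ ∑ i, χ i = 0 ∧
      ∀ i, χ (i + 1) = (Real.cos (k * Real.pi / n) + Real.sin (k * Real.pi / n) * Complex.I) ^ 2
        * χ i := by
  have hk' : (k : ZMod n) ≠ 0 := fun h =>
    hk.not_ge (Nat.le_of_dvd (Nat.pos_of_ne_zero hk0) ((ZMod.natCast_eq_zero_iff k n).1 h))
  refine ⟨fun i => ZMod.stdAddChar ((k : ZMod n) * i), ?_, ?_, fun i => ?_⟩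
  · simp
  · have := AddChar.sum_mulShift (R := ZMod n) (R' := ℂ) (k : ZMod n)
      (ZMod.isPrimitive_stdAddChar n)
    rw [if_neg hk', Nat.cast_zero] at this
    simpa [mul_comm] using this
  · have e := ZMod.stdAddChar_coe (N := n) k
    simp only [Int.cast_natCast] at e
    beta_reduce
    rw [mul_add, mul_one, AddChar.map_add_eq_mul, e, mul_comm, Complex.ofReal_cos,
      Complex.ofReal_sin, ← Complex.exp_mul_I, ← Complex.exp_nat_mul]
    congr 2
    push_cast
    field_simp

theorem coeff_pos_of_stable [NeZero n] {P : Params n} (hμ : 0 < P.μ) (hlam0 : 0 < P.lam) {α : ℝ}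
    (hα : ∀ i, P.α i = α) {m : ℤ} {ξ : Shape n} (hξ : IsCCWCirclingEquilibrium P m ξ)
    (hstable : IsLinearlyStable P ξ) :
    0 < coeffB n m P.lam P.α₀ α := by
  obtain ⟨ha, h⟩ := hξ.isCircling hμ hlam0 hα
  refine pos_of_quadratic_roots_re_neg (b := P.lam * coeffA n m P.lam P.α₀ α ^ 2) fun z hz => ?_
  have := hstable _ (isShapeEigenvalue_of_root_zero hμ hα ha h rfl rfl (ζ := z) (by
    rw [← hz, coeffB, αstar]; push_cast; ring))
  rw [Complex.re_ofReal_mul] at this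
  exact (pos_iff_neg_of_mul_neg this).1 hμ

theorem mode_conditions_of_stable [NeZero n] {P : Params n} (hμ : 0 < P.μ) (hlam0 : 0 < P.lam)
    {α : ℝ} (hα : ∀ i, P.α i = α) {m : ℤ} {ξ : Shape n} (hξ : IsCCWCirclingEquilibrium P m ξ)
    (hstable : IsLinearlyStable P ξ) {k : ℕ} (hk0 : k ≠ 0) (hk : k < n) {z : ℂ}
    (hz : z ^ 3
      + ((cTilde n m P.lam P.α₀ α k : ℝ) + (-cHat n m P.lam P.α₀ α k : ℝ) * Complex.I) * z ^ 2
      + ((coeffA n m P.lam P.α₀ α * dTilde n m P.lam P.α₀ α k : ℝ)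
        + (coeffA n m P.lam P.α₀ α * dHat n m P.lam P.α₀ α k : ℝ) * Complex.I) * z
      + ((coeffA n m P.lam P.α₀ α ^ 2 * eTilde n m P.lam α k : ℝ)
        + (-(coeffA n m P.lam P.α₀ α ^ 2 * eHat n m P.lam α k) : ℝ) * Complex.I) = 0) :
    z.re < 0 := by
  obtain ⟨ha, h⟩ := hξ.isCircling hμ hlam0 hα
  obtain ⟨χ, hχ0, hsum, hχ⟩ := exists_mode (n := n) hk0 hk
  have hA : (1 - P.lam) * Real.cos (m * Real.pi / n - α)
      = (1 - P.lam) * Real.cos (αstar n m α) := rfl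
  have hst : (Real.sin (k * Real.pi / n) : ℂ) ^ 2 + (Real.cos (k * Real.pi / n) : ℂ) ^ 2 = 1 := by
    exact_mod_cast Real.sin_sq_add_cos_sq (k * Real.pi / n)
  unfold cTilde cHat dTilde dHat eTilde eHat coeffD coeffB at hz
  generalize (Real.cos (αstar n m α)) = A at hz hA
  generalize coeffA n m P.lam P.α₀ α = a at hz ha h
  generalize Real.sin (k * Real.pi / n) = s at hz hst hχ
  generalize Real.cos (k * Real.pi / n) = t at hz hst hχ
  generalize hc : Real.cot (m * Real.pi / n) = c at hz
  -- This `q` comes from `1 - ω = 2 (s² - i s t)` and `1 + ω = 2 (t² + i s t)`.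
  have := hstable _ (isShapeEigenvalue_of_root hμ hlam0 hα ha h hχ hχ0 hsum hA rfl hc (ζ := z)
    (q := a * (c * (s ^ 2 - s * t * Complex.I) * z - (t ^ 2 + s * t * Complex.I) * a)) ?_ ?_)
  · rw [Complex.re_ofReal_mul] at this
    exact (pos_iff_neg_of_mul_neg this).1 hμ
  · linear_combination (a * (c * z - a) : ℂ) * hst
      + (a * s ^ 2 * (c * z + a) : ℂ) * Complex.I_sq
  · push_cast at hz ⊢
    linear_combination hz - (a ^ 2 * (z + (1 - P.lam) * A) : ℂ) * hst

theorem hurwitz_conditions_of_stable [NeZero n] {P : Params n} (hμ : 0 < P.μ)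
    (hlam0 : 0 < P.lam) {α : ℝ} (hα : ∀ i, P.α i = α) {m : ℤ} {ξ : Shape n}
    (hξ : IsCCWCirclingEquilibrium P m ξ) (hstable : IsLinearlyStable P ξ) {k : ℕ} (hk0 : k ≠ 0)
    (hk : k < n) :
    0 < cTilde n m P.lam P.α₀ α k ∧
      0 < Gam n m P.lam P.α₀ α k ∧
        0 < Gam n m P.lam P.α₀ α k ^ 2 * eTilde n m P.lam α k
            + Gam n m P.lam P.α₀ α k * Lam n m P.lam P.α₀ α k * dHat n m P.lam P.α₀ α k
            - Lam n m P.lam P.α₀ α k ^ 2 * cTilde n m P.lam P.α₀ α k := by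
  have ha := (hξ.isCircling hμ hlam0 hα).1
  obtain ⟨h₁, h₂, h₃⟩ := hurwitz_complex_cubic fun z =>
    mode_conditions_of_stable hμ hlam0 hα hξ hstable hk0 hk (z := z)
  unfold Gam Lam
  generalize cTilde n m P.lam P.α₀ α k = c at *
  generalize cHat n m P.lam P.α₀ α k = c' at *
  generalize dTilde n m P.lam P.α₀ α k = d at *
  generalize dHat n m P.lam P.α₀ α k = d' at *
  generalize eTilde n m P.lam α k = e at *
  generalize eHat n m P.lam α k = e' at *
  generalize coeffA n m P.lam P.α₀ α = a at *
  -- The Hurwitz expressions are `a Γ_k` and `a⁴` times the last quantity, since the inner bracket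
  -- of the third one is `-a² Λ_k`.
  refine ⟨h₁, pos_of_mul_pos_right (a := a) (h₂.trans_eq (by ring)) ha.le,
    pos_of_mul_pos_right (a := a ^ 4) (h₃.trans_eq (by ring)) (by positivity)⟩

end BeaconPursuit

open BeaconPursuit
theorem theorem2 (n : ℕ) [NeZero n] (P : Params n)
    (hμ : 0 < P.μ) (hlam0 : 0 < P.lam) (hlam1 : P.lam < 1)
    (α : ℝ) (hα : ∀ i, P.α i = α)
    (m : ℤ) (ξ : Shape n) (hξ : IsCCWCirclingEquilibrium P m ξ)
    (hstable : IsLinearlyStable P ξ) :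
    ∀ k < n,
      0 < cTilde n m P.lam P.α₀ α k ∧
      0 < cTilde n m P.lam P.α₀ α k
            * (cTilde n m P.lam P.α₀ α k * dTilde n m P.lam P.α₀ α k
              - coeffA n m P.lam P.α₀ α * eTilde n m P.lam α k)
          - dHat n m P.lam P.α₀ α k
            * (cTilde n m P.lam P.α₀ α k * cHat n m P.lam P.α₀ α k
              + coeffA n m P.lam P.α₀ α * dHat n m P.lam P.α₀ α k) ∧
      (k ≠ 0 →
        0 < Gam n m P.lam P.α₀ α k ^ 2 * eTilde n m P.lam α k
            + Gam n m P.lam P.α₀ α k * Lam n m P.lam P.α₀ α k * dHat n m P.lam P.α₀ α k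
            - Lam n m P.lam P.α₀ α k ^ 2 * cTilde n m P.lam P.α₀ α k) := by
  intro k hk
  rcases eq_or_ne k 0 with rfl | hk0
  -- At `k = 0` only `c̃ = b` and `d̃ = λ a` survive, and the second inequality reads `λ a b² > 0`.
  · have hb := coeff_pos_of_stable hμ hlam0 hα hξ hstable
    have ha := (hξ.isCircling hμ hlam0 hα).1
    simp only [cTilde, cHat, dTilde, dHat, eTilde, Nat.cast_zero, zero_mul, zero_div, Real.sin_zero,
      Real.cos_zero, mul_zero, ne_eq, OfNat.ofNat_ne_zero, not_false_eq_true, zero_pow, one_pow,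
      mul_one, add_zero, zero_add, sub_zero, not_true_eq_false, false_implies, and_true]
    exact ⟨hb, by positivity⟩
  · obtain ⟨h₁, h₂, h₃⟩ := hurwitz_conditions_of_stable hμ hlam0 hα hξ hstable hk0 hk
    refine ⟨h₁, h₂.trans_eq ?_, fun _ => h₃⟩
    rw [Gam]
    ring
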